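/- Let $a\ge 3$ be an odd integer with $\gcd(a,3)=\gcd(a,5)=1$, and let $\alpha=(a-1)/2$. Let $D=[D(j,g)]$ be the $a\times 3$ array over $\mathbb Z/a$, with rows $j=0,\dots,a-1$, given by $D(j,0)=0$, $D(j,1)=j$, $D(j,2)=\alpha j$. Then $D$ is a difference matrix DM$(3;a)$ in standard form: its first column is zero, each of its other columns contains every residue modulo $a$ exactly once, the differences of any two distinct columns contain every residue exactly once, and $D(j,1)=j$. For $i\in\mathbb Z/a$ let $P^i$ be the $a\times a$ circulant permutation matrix whose row $r$ has its only $1$ in column $r-i \bmod a$, and let $R_v$ be the $a\times a$ matrix whose row $v$ is all ones and whose other rows are zero. Let $H$ be the $4a\times a^2$ matrix over $\mathbb F_2$ which is a $4\times a$ array of $a\times a$ blocks, with block column $v$ (for $v=0,\dots,a-1$) consisting, from top to bottom, of $R_v$, $P^{D(v,0)}=I$, $P^{D(v,1)}=P^{v}$, $P^{D(v,2)}=P^{\alpha v}$. Let $\mathcal C$ be the null space of $H$ over $\mathbb F_2$. Then: 1. $H$ is the parity-check matrix of an $(a^2,4,a)$-regular binary code: the code has length $a^2$, every column of $H$ has exactly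 $4$ ones and every row has exactly $a$ ones. 2. The code is quasi-cyclic: after a permutation of its rows and a permutation of its columns, $H$ is a $4\times a$ array of $a\times a$ circulant matrices. 3. The Tanner graph of $H$ (the bipartite graph on rows and columns in which row $r$ and column $c$ are adjacent exactly when $H(r,c)=1$) has girth at least $6$. 4. The rate $\dim(\mathcal C)/a^2$ of the code equals $1-\frac{4a-3}{a^2}$. 5. The minimum distance of $\mathcal C$ is exactly $10$. Moreover, index the columns of $H$ by pairs $(v,q)\in(\mathbb Z/a)^2$, where $(v,q)$ stands for the column in position $q$ of block column $v$, and let $\alpha^{-1}$ be the inverse of $\alpha$ modulo $a$. Then the ten columns $(0,2)$, $(0,\alpha+1)$, $(1,2)$, $(1,\alpha)$, $(2,0)$, $(2,1)$, $(\alpha^{-1},1)$, $(\alpha^{-1},\alpha+1)$, $(\alpha^{-1}+1,0)$, $(\alpha^{-1}+1,\alpha)$ are distinct, and the vector of weight $10$ supported on them is a code word. -/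

import Mathlib

namespace LDPC

section Codes

variable {R C : Type*} [Fintype R] [Fintype C]

/-- The binary code with parity-check matrix `H`: the null space of `H` over `ℤ/2`. -/
def code (H : Matrix R C (ZMod 2)) : Submodule (ZMod 2) (C → ZMod 2) :=
  LinearMap.ker H.mulVecLin

/-- `H` is the parity-check matrix of an `(m, wc, wr)`-regular binary code: the block length is
`m`, every column has exactly `wc` ones and every row has exactly `wr` ones. -/
structure IsRegularParityCheck (H : Matrix R C (ZMod 2)) (m wc wr : ℕ) : Prop where
  length_eq : Fintype.card C = m
  col_weight : ∀ c : C, hammingNorm (fun r => H r c) = wc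
  row_weight : ∀ r : R, hammingNorm (H r) = wr

/-- After a permutation of its rows and a permutation of its columns, `H` is a `K × L` array of
`z × z` circulant matrices. The equivalences `e` and `f` express the two permutations: they name,
for each row and each column of `H`, its block and its position in that block. -/
def IsQuasiCyclicParityCheck (H : Matrix R C (ZMod 2)) (K L z : ℕ) : Prop :=
  ∃ (e : R ≃ Fin K × Fin z) (f : C ≃ Fin L × Fin z), ∀ (i : Fin K) (j : Fin L),
    ∃ w : Fin z → ZMod 2,
      (Matrix.of fun s t => (Matrix.reindex e f H) (i, s) (j, t)) = Matrix.circulant w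

/-- The Tanner graph of `H`: check nodes are the rows, variable nodes are the columns, and row `r`
is joined to column `c` exactly when `H r c = 1`. -/
def tannerGraph (H : Matrix R C (ZMod 2)) : SimpleGraph (R ⊕ C) :=
  SimpleGraph.fromRel fun x y => ∃ r c, x = Sum.inl r ∧ y = Sum.inr c ∧ H r c = 1

/-- The rate `κ / m` of the code with parity-check matrix `H`, where `κ` is the dimension of the
code and `m` is its length. -/
noncomputable def rate (H : Matrix R C (ZMod 2)) : ℚ :=
  (Module.finrank (ZMod 2) (code H) : ℚ) / (Fintype.card C : ℚ)

/-- The minimum Hamming distance between two distinct code words exists and equals `d`. -/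
def HasMinDist (H : Matrix R C (ZMod 2)) (d : ℕ) : Prop :=
  IsLeast {k | ∃ x ∈ code H, ∃ y ∈ code H, x ≠ y ∧ hammingDist x y = k} d

end Codes

/-- A difference matrix `DM(k; a)` with rows indexed by `0, …, a - 1` (as residues modulo `a`):
the first column is zero, each other column contains every residue exactly once, and the
differences of any two distinct columns contain every residue exactly once. -/
structure IsDifferenceMatrix {k a : ℕ} [NeZero k] (D : Matrix (ZMod a) (Fin k) (ZMod a)) :
    Prop where
  first_col : ∀ i, D i 0 = 0
  col_bijective : ∀ j, j ≠ 0 → Function.Bijective fun i => D i j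
  diff_bijective : ∀ j j', j ≠ j' → Function.Bijective fun i => D i j - D i j'

/-- Standard form of a difference matrix with three columns: column `1` is `0, 1, …, a - 1`. -/
def IsStandardForm {a : ℕ} (D : Matrix (ZMod a) (Fin 3) (ZMod a)) : Prop :=
  ∀ i, D i 1 = i

/-- The circulant permutation matrix `P ^ i`: row `r` has its only `1` in column `r - i`. -/
def cpm {a : ℕ} (i : ZMod a) : Matrix (ZMod a) (ZMod a) (ZMod 2) :=
  Matrix.of fun r c => if c = r - i then 1 else 0

/-- The matrix `R_v`: row `v` consists of ones and every other row is zero. -/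
def rowBlock {a : ℕ} (v : ZMod a) : Matrix (ZMod a) (ZMod a) (ZMod 2) :=
  Matrix.of fun r _ => if r = v then 1 else 0

/-- The `4a × a²` matrix `H` built from a difference matrix `D` with three columns. It is a
`4 × a` array of `a × a` blocks whose block column `v` consists of `R_v`, `P ^ D(v,0)`,
`P ^ D(v,1)` and `P ^ D(v,2)`. The index `(u, r)` stands for row `u * a + r` and the index `(v, q)`
for column `v * a + q`. -/
def parityCheck {a : ℕ} (D : Matrix (ZMod a) (Fin 3) (ZMod a)) :
    Matrix (Fin 4 × ZMod a) (ZMod a × ZMod a) (ZMod 2) :=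
  Matrix.of fun (u, r) (v, q) =>
    (![rowBlock v, cpm (D v 0), cpm (D v 1), cpm (D v 2)] u) r q

/-- The array with columns `0`, `j`, `α j`. -/
def linearDM {a : ℕ} (α : ZMod a) : Matrix (ZMod a) (Fin 3) (ZMod a) :=
  Matrix.of fun j => ![0, j, α * j]

/-- The columns supporting the explicit code word of weight ten. -/
def tenColumns {a : ℕ} (α : ZMod a) : Finset (ZMod a × ZMod a) :=
  {(0, 2), (0, α + 1), (1, 2), (1, α), (2, 0), (2, 1), (α⁻¹, 1), (α⁻¹, α + 1),
    (α⁻¹ + 1, 0), (α⁻¹ + 1, α)}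

end LDPC

/-! Column `(v, q)` of `H` is a point of the plane over `ℤ/a`, and the rows are the lines of four
parallel classes, on which `v`, `q`, `v + q` or `α v + q` is constant
(`parityCheck_linearDM_apply`). A code word is a set of points meeting all these lines evenly. The
arithmetic input is `2 α = -1` and the invertibility of `2`, `3`, `5`.

Regularity is a count of points on lines. Lines of different classes share at most one point
(`eq_of_rowVal_eq`), which excludes 4-cycles, and the bipartite Tanner graph has no odd ones. The
coordinates `(q - v, v)` on columns, with a rescaling of each block row, make the blocks circulant.

For the rate, a relation among the rows is a function on lines whose sum over the four lines through
each point is zero. Differencing along three classes leaves a vanishing third difference on the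
fourth; as `2` is invertible in `ℤ/a`, this forces constancy (`const_of_sum_rowVal_eq_zero`). The
relations thus have dimension 3 and the rank is `4a - 3`.

For the distance, the support of a word is paired off along the lines of each class
(`exists_pairing`). A finite search, uniform in `a`, builds such pairings with coordinates that are
integral linear forms in parameters: the partner of a point is either a listed point, which imposes
a linear equation, or a new point, which adds a parameter. Every branch with at most eight points
ends with two points forced to coincide (`refute_initial`, `not_represents_of_refute`). Supports
have even size, so the weight is at least ten, and the explicit word attains it. -/

namespace LDPC

/-! ### A search refuting small configurations that meet every line evenly -/

/-- The value at `t` of an integral linear form whose first coefficient has index `k`. -/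
def formEval {R : Type*} [CommRing R] (t : ℕ → R) : ℕ → List ℤ → R
  | _, [] => 0
  | k, x :: l => x * t k + formEval t (k + 1) l

/-- The linear form `c * f - d * g`. -/
def formComb (c d : ℤ) : List ℤ → List ℤ → List ℤ
  | [], g => g.map fun y => -(d * y)
  | x :: f, [] => c * x :: f.map fun x => c * x
  | x :: f, y :: g => (c * x - d * y) :: formComb c d f g

/-- The form that is `x` times the parameter of index `k`. -/
def formSingle (k : ℕ) (x : ℤ) : List ℤ := List.replicate k 0 ++ [x]

/-- A point whose two coordinates are linear forms in some parameters, together with the list of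
those classes of lines in which its partner is known. -/
structure SymPoint where
  fst : List ℤ
  snd : List ℤ
  done : List ℕ

/-- Coefficients of the linear functional defining a class of lines. -/
def lineCoeff : ℕ → ℤ × ℤ
  | 0 => (1, 0)
  | 1 => (0, 1)
  | 2 => (1, 1)
  | _ => (-1, 2)

/-- The direction of a class of lines. -/
def lineDir : ℕ → ℤ × ℤ
  | 0 => (0, 1)
  | 1 => (1, 0)
  | 2 => (1, -1)
  | _ => (2, 1)

/-- An integer with no prime factors other than `2`, `3`, `5`. -/
def isSmooth (x : ℤ) : Bool := Nat.beq (30 ^ 20 % x.natAbs) 0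

/-- All coefficients vanish, modulo the known annihilators `md` of the parameters. -/
def formVanishes (md : ℕ → ℕ) : ℕ → List ℤ → Bool
  | _, [] => true
  -- Since `x % 0 = x`, the annihilator `0` carries no information and requires the coefficient
  -- itself to be zero.
  | k, x :: l => Nat.beq (x.natAbs % md k) 0 && formVanishes md (k + 1) l

/-- All coefficients agree, modulo the known annihilators `md` of the parameters. -/
def formsAgree (md : ℕ → ℕ) : ℕ → List ℤ → List ℤ → Bool
  | k, [], g => formVanishes md k g
  | k, x :: f, [] => formVanishes md k (x :: f)
  | k, x :: f, y :: g =>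
    match Nat.beq ((x - y).natAbs % md k) 0 with
    | true => formsAgree md (k + 1) f g
    | false => false

/-- The two points are certainly equal. -/
def samePoint (md : ℕ → ℕ) (p q : SymPoint) : Bool :=
  match formsAgree md 0 p.fst q.fst with
  | true => formsAgree md 0 p.snd q.snd
  | false => false

/-- Two of the points are certainly equal. -/
def coincide (md : ℕ → ℕ) : List SymPoint → Bool
  | [] => false
  | p :: l => l.any (samePoint md p) || coincide md l

/-- The first pair of a class and a point whose partner in that class is not known. -/
def pickOpen (pts : List SymPoint) : Option (ℕ × ℕ) :=
  [0, 1, 2, 3].findSome? fun c =>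
    (pts.findIdx? fun p => !p.done.any (Nat.beq c)).map fun i => (c, i)

/-- The first smooth coefficient, with its index. -/
def smoothPivot : ℕ → List ℤ → Option (ℕ × ℤ)
  | _, [] => none
  | k, x :: l => if isSmooth x then some (k, x) else smoothPivot (k + 1) l

/-- The only nonzero coefficient, with its index. -/
def soleCoeff : ℕ → List ℤ → Option (ℕ × ℤ)
  | _, [] => none
  | k, x :: l =>
    match x.natAbs with
    | 0 => soleCoeff (k + 1) l
    | _ + 1 => if formVanishes (fun _ => 0) 0 l then some (k, x) else none

/-- Use the vanishing of the form `L` to eliminate its `k`-th coefficient, which is `c`. -/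
def eliminate (L : List ℤ) (k : ℕ) (c : ℤ) (pts : List SymPoint) : List SymPoint :=
  pts.map fun p => ⟨formComb c (p.fst.getD k 0) p.fst L, formComb c (p.snd.getD k 0) p.snd L, p.done⟩

/-- Exploit the vanishing of the form `L`. -/
def addEq (L : List ℤ) (pts : List SymPoint) (md : ℕ → ℕ) : List SymPoint × (ℕ → ℕ) :=
  match smoothPivot 0 L with
  | some (k, c) => (eliminate L k c pts, md)
  | none =>
    match soleCoeff 0 L with
    | none => (pts, md)
    | some (k, x) =>
      -- Both `md k` and `x` kill the parameter, hence so does their gcd, and the part of it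
      -- dividing `30 ^ 20` is a unit that cancels. Primes such as `7` may divide `a`, so what
      -- remains can only be recorded.
      let g := Nat.gcd (md k) x.natAbs
      let g' := g / Nat.gcd g (30 ^ 20)
      if Nat.beq g' 1 then (eliminate (formSingle k 1) k 1 pts, md)
      else (pts, fun j => if Nat.beq j k then g' else md j)

/-- Record that the partner in class `c` is known. -/
def SymPoint.mark (c : ℕ) (p : SymPoint) : SymPoint := ⟨p.fst, p.snd, c :: p.done⟩

/-- A further point on the line of class `c` through `p`, at the parameter of index `k`. -/
def SymPoint.translate (c k : ℕ) (p : SymPoint) : SymPoint :=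
  ⟨formComb 1 (-1) p.fst (formSingle k (lineDir c).1),
    formComb 1 (-1) p.snd (formSingle k (lineDir c).2), [c]⟩

/-- The form expressing that two points lie on the same line of class `c`. -/
def lineForm (c : ℕ) (p q : SymPoint) : List ℤ :=
  formComb (lineCoeff c).1 (-(lineCoeff c).2) (formComb 1 1 p.fst q.fst) (formComb 1 1 p.snd q.snd)

/-- The parameter of index `k` does not occur so far. -/
def isFresh (k : ℕ) (pts : List SymPoint) (md : ℕ → ℕ) : Bool :=
  Nat.beq (md k) 0 && pts.all fun p => Nat.ble p.fst.length k && Nat.ble p.snd.length k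

/-- Depth-first search for at most eight distinct points that are matched along the lines of every
class. The value `true` certifies that there is no such configuration extending `pts`. -/
def refute : ℕ → List SymPoint → (ℕ → ℕ) → Bool
  | 0, _, _ => false
  | n + 1, pts, md =>
    coincide md pts ||
    match pickOpen pts with
    | none => false
    | some (c, i) =>
      match pts[i]? with
      | none => false
      | some p =>
        ((List.range pts.length).all fun j =>
          match pts[j]? with
          | none => true
          | some q =>
            Nat.beq j i || q.done.any (Nat.beq c) ||
              match addEq (lineForm c p q) pts md with
              | (pts', md') =>
                refute n ((pts'.modify i (SymPoint.mark c)).modify j (SymPoint.mark c)) md') &&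
        -- The first point uses the parameters `0` and `1` and each later point adds one, so
        -- `pts.length + 1` is the next index.
        (Nat.ble 8 pts.length || isFresh (pts.length + 1) pts md &&
          refute n (pts.modify i (SymPoint.mark c) ++ [p.translate c (pts.length + 1)]) md)

/-- The search starts from one point with independent coordinates. Eight points give at most four
pairs in each of four classes, so sixteen pairings, and one further level of depth detects the final
coincidence. -/
theorem refute_initial : refute 17 [⟨[1], [0, 1], []⟩] (fun _ => 0) = true := by
  decide +kernel

/-! ### Values of linear forms, and smooth integers as units -/

section FormEval

variable {R : Type*} [CommRing R] (t : ℕ → R)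

lemma formEval_map_mul (c : ℤ) (k : ℕ) (f : List ℤ) :
    formEval t k (f.map fun x => c * x) = c * formEval t k f := by
  induction f generalizing k with
  | nil => simp [formEval]
  | cons x f ih => simp only [List.map_cons, formEval, ih]; push_cast; ring

lemma formEval_map_neg_mul (c : ℤ) (k : ℕ) (f : List ℤ) :
    formEval t k (f.map fun x => -(c * x)) = -(c * formEval t k f) := by
  induction f generalizing k with
  | nil => simp [formEval]
  | cons x f ih => simp only [List.map_cons, formEval, ih]; push_cast; ring

lemma formEval_comb (c d : ℤ) (k : ℕ) (f g : List ℤ) :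
    formEval t k (formComb c d f g) = c * formEval t k f - d * formEval t k g := by
  induction f generalizing k g with
  | nil => simp [formComb, formEval, formEval_map_neg_mul]
  | cons x f ih =>
    cases g with
    | nil => simp only [formComb, formEval, formEval_map_mul]; push_cast; ring
    | cons y g => simp only [formComb, formEval, ih]; push_cast; ring

lemma formEval_single (j k : ℕ) (x : ℤ) :
    formEval t j (formSingle k x) = x * t (j + k) := by
  induction k generalizing j with
  | zero => simp [formSingle, formEval]
  | succ k ih =>
    have h := ih (j + 1)
    simp only [formSingle] at h ⊢
    rw [List.replicate_succ, List.cons_append, formEval, h]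
    simp [add_comm, add_left_comm]

lemma formEval_congr {t t' : ℕ → R} (k : ℕ) (f : List ℤ)
    (h : ∀ j, k ≤ j → j < k + f.length → t j = t' j) : formEval t k f = formEval t' k f := by
  induction f generalizing k with
  | nil => rfl
  | cons x f ih =>
    simp only [formEval]
    rw [h k le_rfl (by simp), ih (k + 1) fun j hj hj' => h j (by omega) (by simp; omega)]

variable {t}

lemma intCast_mul_eq_zero {n : ℕ} {x : ℤ} {u : R} (hn : (n : R) * u = 0) (h : x.natAbs % n = 0) :
    (x : R) * u = 0 := by
  obtain ⟨z, rfl⟩ := Int.natCast_dvd.2 (Nat.dvd_of_mod_eq_zero h)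
  push_cast
  rw [mul_right_comm, hn, zero_mul]

lemma formEval_eq_zero_of_vanishes {md : ℕ → ℕ} (hmd : ∀ k, (md k : R) * t k = 0) (k : ℕ) (f : List ℤ) (h : formVanishes md k f = true) :
    formEval t k f = 0 := by
  induction f generalizing k with
  | nil => rfl
  | cons x f ih =>
    simp only [formVanishes, Bool.and_eq_true, Nat.beq_eq] at h
    simp only [formEval]
    rw [ih _ h.2, intCast_mul_eq_zero (hmd k) h.1, add_zero]

lemma formEval_eq_of_agree {md : ℕ → ℕ} (hmd : ∀ k, (md k : R) * t k = 0) (k : ℕ) (f g : List ℤ) (h : formsAgree md k f g = true) :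
    formEval t k f = formEval t k g := by
  induction f generalizing k g with
  | nil => rw [formEval_eq_zero_of_vanishes hmd k g (by simpa [formsAgree] using h)]; rfl
  | cons x f ih =>
    cases g with
    | nil => rw [formEval_eq_zero_of_vanishes hmd k _ (by simpa only [formsAgree] using h)]; rfl
    | cons y g =>
      simp only [formsAgree] at h
      split at h
      · rename_i h'
        have := intCast_mul_eq_zero (hmd k) (by simpa using h')
        simp only [formEval]
        rw [ih _ _ h]
        push_cast at this
        linear_combination this
      · simp at h

end FormEval

/-- A divisor of a power of the unit `30` is a unit. The value `x = 0` fails the test because `30 ^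
20 % 0` is not zero. -/
lemma isUnit_of_isSmooth {R : Type*} [CommRing R] (h30 : IsUnit (30 : R)) {x : ℤ}
    (h : isSmooth x = true) : IsUnit (x : R) := by
  have h' : x ∣ 30 ^ 20 := by
    have := Nat.dvd_of_mod_eq_zero (by simpa [isSmooth] using h : 30 ^ 20 % x.natAbs = 0)
    exact Int.natAbs_dvd.1 (by exact_mod_cast this)
  obtain ⟨z, hz⟩ := h'
  have : (30 : R) ^ 20 = x * z := by exact_mod_cast congrArg (Int.cast : ℤ → R) hz
  exact isUnit_of_mul_isUnit_left (this ▸ h30.pow 20)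

lemma isUnit_of_dvd_pow {R : Type*} [CommRing R] (h30 : IsUnit (30 : R)) {n : ℕ}
    (h : n ∣ 30 ^ 20) : IsUnit (n : R) := by
  obtain ⟨z, hz⟩ := h
  have : (30 : R) ^ 20 = n * z := by exact_mod_cast congrArg (Nat.cast : ℕ → R) hz
  exact isUnit_of_mul_isUnit_left (this ▸ h30.pow 20)

lemma smoothPivot_isSmooth {k j : ℕ} {c : ℤ} {l : List ℤ} (h : smoothPivot k l = some (j, c)) :
    isSmooth c = true := by
  induction l generalizing k with
  | nil => simp [smoothPivot] at h
  | cons x l ih =>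
    simp only [smoothPivot] at h
    split at h
    · rename_i hx
      simp only [Option.some.injEq, Prod.mk.injEq] at h
      exact h.2 ▸ hx
    · exact ih h

lemma formEval_of_soleCoeff {R : Type*} [CommRing R] {t : ℕ → R} {k j : ℕ} {x : ℤ} {l : List ℤ}
    (h : soleCoeff k l = some (j, x)) : formEval t k l = x * t j := by
  induction l generalizing k with
  | nil => simp [soleCoeff] at h
  | cons y l ih =>
    simp only [soleCoeff] at h
    split at h
    · rename_i hy
      simp only [formEval, ih h, Int.natAbs_eq_zero.1 hy]
      simp
    · split at h
      · rename_i hl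
        simp only [Option.some.injEq, Prod.mk.injEq] at h
        obtain ⟨rfl, rfl⟩ := h
        have h0 : formVanishes (fun _ => 0) (k + 1) l = true := by
          have key : ∀ i i' (l : List ℤ), formVanishes (fun _ => 0) i l =
              formVanishes (fun _ => 0) i' l := by
            intro i i' l
            induction l generalizing i i' with
            | nil => rfl
            | cons z l ih => simp only [formVanishes]; rw [ih (i + 1) (i' + 1)]
          rw [key _ 0, hl]
        simp [formEval, formEval_eq_zero_of_vanishes (t := t) (md := fun _ => 0) (by simp) _ _ h0]
      · simp at h

/-! ### Actual configurations described by symbolic ones -/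

/-- The linear functional defining a class of lines. -/
def lineVal {R : Type*} [CommRing R] (c : ℕ) (x : R × R) : R :=
  (lineCoeff c).1 * x.1 + (lineCoeff c).2 * x.2

/-- `P` lists distinct points of `S` that are represented, up to the common unit `u`, by the
forms in `pts` at the parameter values `t`; partners recorded as known are among them. -/
structure Represents {R : Type*} [CommRing R] (S : Finset (R × R)) (m : ℕ → R × R → R × R)
    (pts : List SymPoint) (md : ℕ → ℕ) (u : R) (t : ℕ → R) (P : ℕ → R × R) : Prop where
  isUnit : IsUnit u
  mem : ∀ i < pts.length, P i ∈ S
  inj : ∀ i < pts.length, ∀ j < pts.length, P i = P j → i = j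
  annihilates : ∀ k, (md k : R) * t k = 0
  fst : ∀ i p, pts[i]? = some p → u * (P i).1 = formEval t 0 p.fst
  snd : ∀ i p, pts[i]? = some p → u * (P i).2 = formEval t 0 p.snd
  partner : ∀ i p, pts[i]? = some p → ∀ c ∈ p.done,
    ∃ j q, pts[j]? = some q ∧ c ∈ q.done ∧ m c (P i) = P j

/-- `m c` matches the points of `S` in pairs along the lines of class `c`. -/
def IsLineMatching {R : Type*} [CommRing R] (S : Finset (R × R)) (m : ℕ → R × R → R × R) : Prop :=
  ∀ c, ∀ x ∈ S, m c x ∈ S ∧ m c x ≠ x ∧ m c (m c x) = x ∧ lineVal c (m c x) = lineVal c x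


section Soundness

variable {R : Type*} [CommRing R] {S : Finset (R × R)} {m : ℕ → R × R → R × R}
  {pts : List SymPoint} {md : ℕ → ℕ} {u : R} {t : ℕ → R} {P : ℕ → R × R}

/-- As `L` vanishes at `t`, replacing `f` by `c f - f_k L` multiplies every value by the same unit
`c`, which is absorbed in the common factor `u`. No division is needed. -/
lemma Represents.eliminate (h : Represents S m pts md u t P) {L : List ℤ}
    (hL : formEval t 0 L = 0) (k : ℕ) {c : ℤ} (hc : IsUnit (c : R)) :
    Represents S m (eliminate L k c pts) md (c * u) t P where
  isUnit := hc.mul h.isUnit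
  mem i hi := h.mem i (by simpa [LDPC.eliminate] using hi)
  inj i hi j hj := h.inj i (by simpa [LDPC.eliminate] using hi) j
    (by simpa [LDPC.eliminate] using hj)
  annihilates := h.annihilates
  fst i p hp := by
    simp only [LDPC.eliminate, List.getElem?_map, Option.map_eq_some_iff] at hp
    obtain ⟨q, hq, rfl⟩ := hp
    simp only [formEval_comb, hL, ← h.fst i q hq]
    ring
  snd i p hp := by
    simp only [LDPC.eliminate, List.getElem?_map, Option.map_eq_some_iff] at hp
    obtain ⟨q, hq, rfl⟩ := hp
    simp only [formEval_comb, hL, ← h.snd i q hq]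
    ring
  partner i p hp d hd := by
    simp only [LDPC.eliminate, List.getElem?_map, Option.map_eq_some_iff] at hp ⊢
    obtain ⟨q, hq, rfl⟩ := hp
    obtain ⟨j, r, hj, hr, e⟩ := h.partner i q hq d hd
    exact ⟨j, _, ⟨r, hj, rfl⟩, hr, e⟩

lemma Represents.addEq (h30 : IsUnit (30 : R)) (h : Represents S m pts md u t P) {L : List ℤ}
    (hL : formEval t 0 L = 0) :
    ∃ v, Represents S m (addEq L pts md).1 (addEq L pts md).2 v t P := by
  unfold LDPC.addEq
  split
  · rename_i k c hk
    exact ⟨_, h.eliminate hL k (isUnit_of_isSmooth h30 (smoothPivot_isSmooth hk))⟩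
  · split
    · exact ⟨u, h⟩
    · rename_i k x hx
      have hx0 : (x : R) * t k = 0 := by rw [← formEval_of_soleCoeff hx, hL]
      set g := Nat.gcd (md k) x.natAbs with hg
      -- By Bézout, `g` is a combination of two annihilators of `t k`.
      have hg0 : (g : R) * t k = 0 := by
        have hb : (g : ℤ) = md k * Nat.gcdA (md k) x.natAbs +
          (x.natAbs : ℤ) * Nat.gcdB (md k) x.natAbs := Nat.gcd_eq_gcd_ab _ _
        have hb' : (g : R) = md k * (Nat.gcdA (md k) x.natAbs : R) +
            ((x.natAbs : ℤ) : R) * (Nat.gcdB (md k) x.natAbs : R) := by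
          exact_mod_cast congrArg (Int.cast : ℤ → R) hb
        have ha : ((x.natAbs : ℤ) : R) * t k = 0 := by
          rcases Int.natAbs_eq x with e | e
          · rw [← e, hx0]
          · rw [show (x.natAbs : ℤ) = -x by omega, Int.cast_neg, neg_mul, hx0, neg_zero]
        rw [hb']
        linear_combination (Nat.gcdA (md k) x.natAbs : R) * h.annihilates k +
          (Nat.gcdB (md k) x.natAbs : R) * ha
      have hg1 : ((g / Nat.gcd g (30 ^ 20) : ℕ) : R) * t k = 0 := by
        have hu := isUnit_of_dvd_pow h30 (Nat.gcd_dvd_right g (30 ^ 20))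
        refine (hu.mul_right_eq_zero).1 ?_
        rw [← mul_assoc, ← Nat.cast_mul, Nat.mul_div_cancel' (Nat.gcd_dvd_left _ _), hg0]
      dsimp only
      split
      · rename_i h1
        rw [Nat.eq_of_beq_eq_true h1, Nat.cast_one, one_mul] at hg1
        refine ⟨_, h.eliminate (c := 1) ?_ k (by simp)⟩
        simp [formEval_single, hg1]
      · refine ⟨u, { h with annihilates := fun j => ?_ }⟩
        dsimp only
        split
        · rename_i hj
          rw [Nat.eq_of_beq_eq_true hj, hg1]
        · exact h.annihilates j

/-- Forms that agree modulo the annihilators take equal values, and the unit `u` cancels; but the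
listed points are distinct. -/
lemma Represents.not_coincide (h : Represents S m pts md u t P) : coincide md pts = false := by
  by_contra hne
  have key : ∀ l : List SymPoint, coincide md l = true →
      ∃ (i j : ℕ) (p q : SymPoint), i < j ∧ l[i]? = some p ∧ l[j]? = some q ∧ samePoint md p q = true := by
    intro l
    induction l with
    | nil => simp [coincide]
    | cons p l ih =>
      intro hl
      simp only [coincide, Bool.or_eq_true, List.any_eq_true] at hl
      rcases hl with ⟨q, hq, hs⟩ | hl
      · obtain ⟨j, hj⟩ := List.mem_iff_getElem?.1 hq
        exact ⟨0, j + 1, p, q, by omega, by simp, by simpa using hj, hs⟩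
      · obtain ⟨i, j, p', q, hij, hi, hj, hs⟩ := ih hl
        exact ⟨i + 1, j + 1, p', q, by omega, by simpa using hi, by simpa using hj, hs⟩
  obtain ⟨i, j, p, q, hij, hi, hj, hs⟩ := key pts (by simpa using hne)
  have hil : i < pts.length := (List.getElem?_eq_some_iff.1 hi).1
  have hjl : j < pts.length := (List.getElem?_eq_some_iff.1 hj).1
  simp only [samePoint] at hs
  split at hs
  · rename_i h1
    have e1 := formEval_eq_of_agree h.annihilates _ _ _ h1
    have e2 := formEval_eq_of_agree h.annihilates _ _ _ hs
    rw [← h.fst i p hi, ← h.fst j q hj] at e1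
    rw [← h.snd i p hi, ← h.snd j q hj] at e2
    have := h.inj i hil j hjl
      (Prod.ext (h.isUnit.mul_left_cancel e1) (h.isUnit.mul_left_cancel e2))
    omega
  · simp at hs

lemma formEval_lineForm (h : Represents S m pts md u t P) {i j : ℕ} {p q : SymPoint}
    (hi : pts[i]? = some p) (hj : pts[j]? = some q) (c : ℕ) :
    formEval t 0 (lineForm c p q) = u * (lineVal c (P i) - lineVal c (P j)) := by
  simp only [lineForm, formEval_comb, ← h.fst i p hi, ← h.fst j q hj, ← h.snd i p hi,
    ← h.snd j q hj, lineVal]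
  push_cast
  ring

lemma exists_of_getElem?_modify_mark {i k c : ℕ} {p : SymPoint}
    (hp : (pts.modify i (SymPoint.mark c))[k]? = some p) :
    ∃ q, pts[k]? = some q ∧ p.fst = q.fst ∧ p.snd = q.snd ∧
      ∀ d, d ∈ p.done → d ∈ q.done ∨ (d = c ∧ k = i) := by
  rw [List.getElem?_modify, Option.map_eq_map, Option.map_eq_some_iff] at hp
  obtain ⟨q, hq, rfl⟩ := hp
  refine ⟨q, hq, ?_⟩
  by_cases h : i = k
  · simp only [h, if_true, SymPoint.mark, List.mem_cons]
    tauto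
  · simp only [h, if_false]
    tauto

lemma exists_getElem?_modify_mark {i k c : ℕ} {q : SymPoint} (hq : pts[k]? = some q) :
    ∃ p, (pts.modify i (SymPoint.mark c))[k]? = some p ∧
      ∀ d, (d ∈ q.done ∨ (d = c ∧ k = i)) → d ∈ p.done := by
  refine ⟨if i = k then SymPoint.mark c q else q, ?_, ?_⟩
  · rw [List.getElem?_modify, hq]; rfl
  · intro d hd
    by_cases h : i = k
    · simp only [h, if_true, SymPoint.mark, List.mem_cons]
      tauto
    · simp only [h, if_false]
      have := Ne.symm h
      tauto

lemma Represents.mark (hm : IsLineMatching S m) (h : Represents S m pts md u t P) {i j : ℕ}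
    (hi : i < pts.length) (hj : j < pts.length) {c : ℕ} (e : m c (P i) = P j) :
    Represents S m ((pts.modify i (SymPoint.mark c)).modify j (SymPoint.mark c)) md u t P := by
  have key : ∀ k p, ((pts.modify i (SymPoint.mark c)).modify j (SymPoint.mark c))[k]? = some p →
      ∃ q, pts[k]? = some q ∧ p.fst = q.fst ∧ p.snd = q.snd ∧
        ∀ d, d ∈ p.done → d ∈ q.done ∨ (d = c ∧ (k = i ∨ k = j)) := by
    intro k p hp
    obtain ⟨r, hr, e1, e2, h1⟩ := exists_of_getElem?_modify_mark hp
    obtain ⟨q, hq, e3, e4, h2⟩ := exists_of_getElem?_modify_mark hr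
    refine ⟨q, hq, e1.trans e3, e2.trans e4, fun d hd => ?_⟩
    rcases h1 d hd with hd | hd
    · rcases h2 d hd with hd | hd <;> tauto
    · tauto
  have key' : ∀ k q, pts[k]? = some q →
      ∃ p, ((pts.modify i (SymPoint.mark c)).modify j (SymPoint.mark c))[k]? = some p ∧
        ∀ d, (d ∈ q.done ∨ (d = c ∧ (k = i ∨ k = j))) → d ∈ p.done := by
    intro k q hq
    obtain ⟨r, hr, h1⟩ := exists_getElem?_modify_mark (i := i) (c := c) hq
    obtain ⟨p, hp, h2⟩ := exists_getElem?_modify_mark (i := j) (c := c) hr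
    refine ⟨p, hp, fun d hd => ?_⟩
    rcases hd with hd | ⟨hd, hk | hk⟩
    · exact h2 d (Or.inl (h1 d (Or.inl hd)))
    · exact h2 d (Or.inl (h1 d (Or.inr ⟨hd, hk⟩)))
    · exact h2 d (Or.inr ⟨hd, hk⟩)
  refine ⟨h.isUnit, fun k hk => h.mem k (by simpa using hk), ?_, h.annihilates, ?_, ?_, ?_⟩
  · intro k hk l hl
    exact h.inj k (by simpa using hk) l (by simpa using hl)
  · intro k p hp
    obtain ⟨q, hq, e1, -, -⟩ := key k p hp
    rw [e1, h.fst k q hq]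
  · intro k p hp
    obtain ⟨q, hq, -, e1, -⟩ := key k p hp
    rw [e1, h.snd k q hq]
  · intro k p hp d hd
    obtain ⟨q, hq, -, -, hdone⟩ := key k p hp
    rcases hdone d hd with hd' | ⟨rfl, rfl | rfl⟩
    · obtain ⟨l, r, hl, hr, e'⟩ := h.partner k q hq d hd'
      obtain ⟨r', hr', hd''⟩ := key' l r hl
      exact ⟨l, r', hr', hd'' d (Or.inl hr), e'⟩
    · obtain ⟨r', hr', hd''⟩ := key' j _ (List.getElem?_eq_getElem hj)
      exact ⟨j, r', hr', hd'' d (by simp), e⟩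
    · obtain ⟨r', hr', hd''⟩ := key' i _ (List.getElem?_eq_getElem hi)
      exact ⟨i, r', hr', hd'' d (by simp), by rw [← e, (hm d _ (h.mem i hi)).2.2.1]⟩

/-- Each direction has a coordinate equal to `1`, so `s` is the difference in that coordinate, over
any commutative ring. -/
lemma exists_eq_add_lineDir (c : ℕ) {x y : R × R}
    (h : lineVal c x = lineVal c y) :
    ∃ s : R, y = (x.1 + (lineDir c).1 * s, x.2 + (lineDir c).2 * s) := by
  match c with
  | 0 => exact ⟨y.2 - x.2, by ext <;> simp_all [lineVal, lineDir, lineCoeff]⟩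
  | 1 => exact ⟨y.1 - x.1, by ext <;> simp_all [lineVal, lineDir, lineCoeff]⟩
  | 2 =>
    refine ⟨y.1 - x.1, ?_⟩
    simp only [lineVal, lineDir, lineCoeff, Int.cast_one, one_mul] at h ⊢
    ext
    · simp
    · push_cast; linear_combination -h
  | (n + 3) =>
    refine ⟨y.2 - x.2, ?_⟩
    simp only [lineVal, lineDir, lineCoeff] at h ⊢
    push_cast at h ⊢
    ext
    · linear_combination h
    · simp

lemma isFresh_iff {k : ℕ} : isFresh k pts md = true ↔
    md k = 0 ∧ ∀ p ∈ pts, p.fst.length ≤ k ∧ p.snd.length ≤ k := by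
  rw [isFresh, Bool.and_eq_true, Nat.beq_eq, List.all_eq_true]
  simp only [Bool.and_eq_true, Nat.ble_eq]

/-- The case of a partner that is not yet listed: it differs from `P i` by a multiple `s` of the
line direction, and `s` becomes the value of an unused parameter. -/
lemma Represents.append (hm : IsLineMatching S m)
    (h : Represents S m pts md u t P) {i : ℕ} {p : SymPoint} (hi : pts[i]? = some p) {c : ℕ}
    (hnew : ∀ j < pts.length, m c (P i) ≠ P j) {k : ℕ} (hk : isFresh k pts md = true) :
    ∃ t' P', Represents S m (pts.modify i (SymPoint.mark c) ++ [p.translate c k]) md u t' P' := by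
  obtain ⟨hmdk, hlen⟩ := isFresh_iff.1 hk
  have hil : i < pts.length := (List.getElem?_eq_some_iff.1 hi).1
  obtain ⟨hmem, -, hinv, hline⟩ := hm c _ (h.mem i hil)
  obtain ⟨s, hs⟩ := exists_eq_add_lineDir c hline.symm
  -- Forms represent `u` times the coordinates, hence `u * s`. Existing forms have length at most
  -- `k` and keep their values.
  set t' : ℕ → R := Function.update t k (u * s) with ht'
  have hev : ∀ f : List ℤ, f.length ≤ k → formEval t' 0 f = formEval t 0 f := fun f hf =>
    formEval_congr 0 f fun j _ hj => by
      rw [ht', Function.update_of_ne (by omega)]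
  have hpm := hlen p (List.mem_of_getElem? hi)
  set n := pts.length with hn
  set P' : ℕ → R × R := Function.update P n (m c (P i)) with hP'
  have hP : ∀ j < n, P' j = P j := fun j hj => by rw [hP', Function.update_of_ne (by omega)]
  have hPn : P' n = m c (P i) := by rw [hP', Function.update_self]
  have hlast : (pts.modify i (SymPoint.mark c) ++ [p.translate c k])[n]? =
      some (p.translate c k) := by
    rw [List.getElem?_append_right (by simp [hn])]; simp [hn]
  have key : ∀ j q, (pts.modify i (SymPoint.mark c) ++ [p.translate c k])[j]? = some q →
      (j = n ∧ q = p.translate c k) ∨ (j < n ∧ ∃ r, pts[j]? = some r ∧ q.fst = r.fst ∧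
        q.snd = r.snd ∧ ∀ d, d ∈ q.done → d ∈ r.done ∨ (d = c ∧ j = i)) := by
    intro j q hq
    by_cases hj : j < n
    · right
      refine ⟨hj, ?_⟩
      rw [List.getElem?_append_left (by simpa using hj)] at hq
      exact exists_of_getElem?_modify_mark hq
    · left
      have hjn : j = n := by
        have := (List.getElem?_eq_some_iff.1 hq).1
        simp at this
        omega
      subst hjn
      rw [hlast, Option.some.injEq] at hq
      exact ⟨rfl, hq.symm⟩
  have key' : ∀ j r, pts[j]? = some r →
      ∃ q, (pts.modify i (SymPoint.mark c) ++ [p.translate c k])[j]? = some q ∧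
        ∀ d, (d ∈ r.done ∨ (d = c ∧ j = i)) → d ∈ q.done := by
    intro j r hr
    have hj : j < n := (List.getElem?_eq_some_iff.1 hr).1
    rw [List.getElem?_append_left (by simpa using hj)]
    exact exists_getElem?_modify_mark hr
  refine ⟨t', P', h.isUnit, ?_, ?_, ?_, ?_, ?_, ?_⟩
  · intro j hj
    rcases Nat.lt_or_ge j n with hj' | hj'
    · rw [hP j hj']; exact h.mem j hj'
    · obtain rfl : j = n := by simp at hj; omega
      rw [hPn]; exact hmem
  · intro j hj l hl e
    simp only [List.length_append, List.length_modify, List.length_singleton] at hj hl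
    rcases Nat.lt_or_ge j n with hj' | hj' <;> rcases Nat.lt_or_ge l n with hl' | hl'
    · rw [hP j hj', hP l hl'] at e; exact h.inj j hj' l hl' e
    · obtain rfl : l = n := by omega
      rw [hP j hj', hPn] at e; exact absurd e.symm (hnew j hj')
    · obtain rfl : j = n := by omega
      rw [hP l hl', hPn] at e; exact absurd e (hnew l hl')
    · omega
  · intro j
    by_cases hj : j = k
    · rw [hj, hmdk]; simp
    · rw [ht', Function.update_of_ne hj]; exact h.annihilates j
  · intro j q hq
    rcases key j q hq with ⟨rfl, rfl⟩ | ⟨hj, r, hr, e1, -, -⟩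
    · rw [hPn, hs]
      simp only [SymPoint.translate, formEval_comb, hev _ hpm.1, ← h.fst i p hi, formEval_single]
      simp [ht']
      ring
    · rw [e1, hP j hj, hev _ (hlen r (List.mem_of_getElem? hr)).1, h.fst j r hr]
  · intro j q hq
    rcases key j q hq with ⟨rfl, rfl⟩ | ⟨hj, r, hr, -, e1, -⟩
    · rw [hPn, hs]
      simp only [SymPoint.translate, formEval_comb, hev _ hpm.2, ← h.snd i p hi, formEval_single]
      simp [ht']
      ring
    · rw [e1, hP j hj, hev _ (hlen r (List.mem_of_getElem? hr)).2, h.snd j r hr]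
  · intro j q hq d hd
    rcases key j q hq with ⟨rfl, rfl⟩ | ⟨hj, r, hr, -, -, hdone⟩
    · obtain rfl : d = c := by simpa [SymPoint.translate] using hd
      obtain ⟨q, hq, hd'⟩ := key' i p hi
      exact ⟨i, q, hq, hd' _ (by simp), by rw [hPn, hinv, hP i hil]⟩
    · rcases hdone d hd with hd' | ⟨rfl, rfl⟩
      · obtain ⟨l, r', hl, hr', e'⟩ := h.partner j r hr d hd'
        obtain ⟨q', hq', hd''⟩ := key' l r' hl
        exact ⟨l, q', hq', hd'' d (Or.inl hr'), by
          rw [hP j hj, hP l (List.getElem?_eq_some_iff.1 hl).1, e']⟩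
      · exact ⟨n, _, hlast, by simp [SymPoint.translate], by rw [hP j hj, hPn]⟩

lemma pickOpen_spec {c i : ℕ} (h : pickOpen pts = some (c, i)) {p : SymPoint}
    (hi : pts[i]? = some p) : c ∉ p.done := by
  obtain ⟨d, -, hd⟩ := List.exists_of_findSome?_eq_some h
  simp only [Option.map_eq_some_iff, Prod.mk.injEq] at hd
  obtain ⟨j, hj, rfl, rfl⟩ := hd
  obtain ⟨hlt, hj', -⟩ := List.findIdx?_eq_some_iff_getElem.1 hj
  rw [List.getElem?_eq_getElem hlt, Option.some.injEq] at hi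
  subst hi
  simp only [Bool.not_eq_true', List.any_eq_false, Nat.beq_eq] at hj'
  exact fun hmem => hj' d hmem rfl

/-- An actual configuration selects a branch of the search: the true partner `m c (P i)` is either
listed or new, and the state reached on that branch still represents the configuration. Induction on
the depth reaches a contradiction. -/
theorem not_represents_of_refute (h30 : IsUnit (30 : R)) (hS : S.card ≤ 8)
    (hm : IsLineMatching S m) (n : ℕ) (href : refute n pts md = true) :
    ¬ Represents S m pts md u t P := by
  classical
  induction n generalizing pts md u t P with
  | zero => simp [refute] at href
  | succ n ih =>
    intro h
    simp only [refute, h.not_coincide, Bool.false_or] at href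
    split at href
    · simp at href
    rename_i c i hpick
    split at href
    · simp at href
    rename_i p hi
    have hil : i < pts.length := (List.getElem?_eq_some_iff.1 hi).1
    simp only [Bool.and_eq_true, List.all_eq_true, List.mem_range, Bool.or_eq_true] at href
    obtain ⟨hall, hnew⟩ := href
    obtain ⟨hmem, hne, hinv, hline⟩ := hm c _ (h.mem i hil)
    by_cases hex : ∃ j < pts.length, m c (P i) = P j
    · obtain ⟨j, hj, e⟩ := hex
      have hj' : pts[j]? = some pts[j] := List.getElem?_eq_getElem hj
      have := hall j hj
      simp only [hj', Bool.or_eq_true] at this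
      rcases this with (hji | hdone) | hrec
      · rw [← Nat.eq_of_beq_eq_true hji] at e
        have hji' := Nat.eq_of_beq_eq_true hji
        subst hji'
        exact hne e
      -- If `P j` already has a listed partner in class `c`, that partner is `P i` by involutivity,
      -- so `c` would be closed at `i`.
      · obtain ⟨l, q, hl, hq, e'⟩ := h.partner j _ hj' c (by simpa using hdone)
        rw [← e, hinv] at e'
        have hil' := h.inj i hil l (List.getElem?_eq_some_iff.1 hl).1 e'
        subst hil'
        rw [hi, Option.some.injEq] at hl
        subst hl
        exact pickOpen_spec hpick hi hq
      · have hL : formEval t 0 (lineForm c p pts[j]) = 0 := by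
          rw [formEval_lineForm h hi hj', ← e, hline, sub_self, mul_zero]
        obtain ⟨v, hv⟩ := h.addEq h30 hL
        have hlen : (addEq (lineForm c p pts[j]) pts md).1.length = pts.length := by
          unfold LDPC.addEq
          split
          · simp [LDPC.eliminate]
          · split
            · rfl
            · dsimp only
              split <;> simp [LDPC.eliminate]
        exact ih hrec (hv.mark hm (hlen ▸ hil) (hlen ▸ hj) e)
    · push Not at hex
      rcases hnew with h8 | ⟨hfresh, hrec⟩
      · have h8' := Nat.le_of_ble_eq_true h8
        -- Eight listed points and a new one would be nine points of `S`.
        have hsub : insert (m c (P i)) ((Finset.range pts.length).image P) ⊆ S := by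
          intro x hx
          simp only [Finset.mem_insert, Finset.mem_image, Finset.mem_range] at hx
          rcases hx with rfl | ⟨j, hj, rfl⟩
          · exact hmem
          · exact h.mem j hj
        have hcard := Finset.card_le_card hsub
        rw [Finset.card_insert_of_notMem, Finset.card_image_of_injOn, Finset.card_range] at hcard
        · omega
        · intro j hj l hl e
          exact h.inj j (by simpa using hj) l (by simpa using hl) e
        · simp only [Finset.mem_image, Finset.mem_range, not_exists, not_and]
          exact fun j hj e => hex j hj e.symm
      · obtain ⟨t', P', h'⟩ := h.append hm hi hex hfresh
        exact ih hrec h'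

/-- A nonempty set that is matched along the lines of all classes has more than eight points. -/
theorem eight_lt_card_of_isLineMatching (h30 : IsUnit (30 : R)) (hm : IsLineMatching S m)
    (hne : S.Nonempty) : 8 < S.card := by
  by_contra! hS
  obtain ⟨x, hx⟩ := hne
  refine not_represents_of_refute h30 hS hm 17 refute_initial (u := 1)
    (t := fun k => if k = 0 then x.1 else if k = 1 then x.2 else 0) (P := fun _ => x) ?_
  constructor
  · exact isUnit_one
  · exact fun _ _ => hx
  · intro i hi j hj _
    simp at hi hj
    omega
  · simp
  · intro i p hp
    obtain ⟨hi, rfl⟩ := List.getElem?_eq_some_iff.1 hp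
    simp at hi
    subst hi
    simp [formEval]
  · intro i p hp
    obtain ⟨hi, rfl⟩ := List.getElem?_eq_some_iff.1 hp
    simp at hi
    subst hi
    simp [formEval]
  · intro i p hp
    obtain ⟨hi, rfl⟩ := List.getElem?_eq_some_iff.1 hp
    simp at hi
    subst hi
    simp

end Soundness

/-! ### Pairing off a set with even fibres -/

/-- Remove two points of one fibre, which keeps all fibres even, and let the pairing swap them. -/
lemma exists_pairing {V β : Type*} [DecidableEq V] [DecidableEq β] (S : Finset V) (f : V → β)
    (h : ∀ b, Even (S.filter fun x => f x = b).card) :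
    ∃ m : V → V, ∀ x ∈ S, m x ∈ S ∧ m x ≠ x ∧ m (m x) = x ∧ f (m x) = f x := by
  induction S using Finset.strongInduction with
  | H S ih =>
    rcases S.eq_empty_or_nonempty with rfl | ⟨x, hx⟩
    · exact ⟨id, by simp⟩
    have hmem : x ∈ S.filter fun z => f z = f x := by simp [hx]
    have hone : 1 < (S.filter fun z => f z = f x).card := by
      have hpos := Finset.card_pos.2 ⟨x, hmem⟩
      obtain ⟨r, hr⟩ := h (f x)
      omega
    obtain ⟨y, hy, hyx⟩ := Finset.exists_mem_ne hone x
    obtain ⟨hyS, hfy⟩ := Finset.mem_filter.1 hy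
    set T := (S.erase x).erase y with hT
    have hyT : y ∈ S.erase x := Finset.mem_erase.2 ⟨hyx, hyS⟩
    have hTS : T ⊂ S := Finset.ssubset_of_subset_of_ssubset (Finset.erase_subset _ _)
      (Finset.erase_ssubset hx)
    obtain ⟨m, hm⟩ := ih T hTS fun b => by
      by_cases hb : f x = b
      · subst hb
        rw [hT, Finset.filter_erase, Finset.filter_erase, Finset.card_erase_of_mem
          (Finset.mem_erase.2 ⟨hyx, hy⟩), Finset.card_erase_of_mem hmem]
        obtain ⟨r, hr⟩ := h (f x)
        exact ⟨r - 1, by omega⟩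
      · rw [hT, Finset.filter_erase, Finset.filter_erase, Finset.erase_eq_of_notMem,
          Finset.erase_eq_of_notMem]
        · exact h b
        · simp [hb]
        · simp [hfy, hb]
    refine ⟨fun z => if z = x then y else if z = y then x else m z, fun z hz => ?_⟩
    by_cases hzx : z = x
    · subst hzx
      simp [hyS, hyx, hfy]
    by_cases hzy : z = y
    · subst hzy
      simp [hx, hyx, Ne.symm hyx, hfy]
    have hzT : z ∈ T := by simp [hT, hzx, hzy, hz]
    obtain ⟨h1, h2, h3, h4⟩ := hm z hzT
    have h1' := h1
    simp only [hT, Finset.mem_erase] at h1'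
    simp [hzx, hzy, h1', h2, h3, h4]

/-! ### Rows as lines: regularity and the difference matrix -/

/-- The value at a column of the linear form whose fibres are the checks of a block row. -/
def rowVal {R : Type*} [CommRing R] (α : R) (u : Fin 4) (b : R × R) : R :=
  ![b.1, b.2, b.1 + b.2, α * b.1 + b.2] u

variable {a : ℕ}

lemma parityCheck_linearDM_apply (α : ZMod a) (u : Fin 4) (r : ZMod a) (b : ZMod a × ZMod a) :
    parityCheck (linearDM α) (u, r) b = if rowVal α u b = r then 1 else 0 := by
  obtain ⟨v, q⟩ := b
  fin_cases u
  · simp [parityCheck, rowBlock, rowVal, eq_comm]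
  · simp [parityCheck, cpm, linearDM, rowVal]
    exact if_congr Iff.rfl rfl rfl
  · simp [parityCheck, cpm, linearDM, rowVal, eq_sub_iff_add_eq']
    exact if_congr Iff.rfl rfl rfl
  · simp [parityCheck, cpm, linearDM, rowVal, eq_sub_iff_add_eq']
    exact if_congr Iff.rfl rfl rfl

/-- A parametrization of the fibres of `rowVal`. -/
def linePoint {R : Type*} [CommRing R] (α : R) (u : Fin 4) (r s : R) : R × R :=
  ![(r, s), (s, r), (s, r - s), (s, r - α * s)] u

lemma rowVal_eq_iff_mem_image [NeZero a] (α : ZMod a) (u : Fin 4) (r : ZMod a)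
    (b : ZMod a × ZMod a) : rowVal α u b = r ↔ ∃ s, linePoint α u r s = b := by
  obtain ⟨v, q⟩ := b
  fin_cases u <;> simp [rowVal, linePoint, Prod.ext_iff, eq_comm, eq_sub_iff_add_eq']

lemma linePoint_injective {R : Type*} [CommRing R] (α : R) (u : Fin 4) (r : R) :
    Function.Injective (linePoint α u r) := by
  intro s t h
  fin_cases u <;> simp_all [linePoint]

theorem isRegularParityCheck_linearDM [NeZero a] (α : ZMod a) :
    IsRegularParityCheck (parityCheck (linearDM α)) (a ^ 2) 4 a where
  length_eq := by simp [ZMod.card, sq]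
  col_weight b := by
    have : (Finset.univ.filter fun r => parityCheck (linearDM α) r b ≠ 0) =
        Finset.univ.image fun u => (u, rowVal α u b) := by
      ext ⟨u, r⟩
      simp [parityCheck_linearDM_apply]
    rw [hammingNorm, this, Finset.card_image_of_injective _ fun u u' h => (Prod.ext_iff.1 h).1]
    simp
  row_weight r := by
    obtain ⟨u, r⟩ := r
    have : (Finset.univ.filter fun b => parityCheck (linearDM α) (u, r) b ≠ 0) =
        Finset.univ.image (linePoint α u r) := by
      ext b
      simp [parityCheck_linearDM_apply, rowVal_eq_iff_mem_image]
    rw [hammingNorm, this, Finset.card_image_of_injective _ (linePoint_injective α u r)]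
    simp [ZMod.card]

lemma mem_code_linearDM_iff [NeZero a] {α : ZMod a} {x : ZMod a × ZMod a → ZMod 2} :
    x ∈ code (parityCheck (linearDM α)) ↔
      ∀ u r, ∑ b, (if rowVal α u b = r then x b else 0) = 0 := by
  simp only [code, LinearMap.mem_ker, Matrix.mulVecLin_apply, funext_iff, Matrix.mulVec,
    dotProduct, Pi.zero_apply, Prod.forall, parityCheck_linearDM_apply, ite_mul, one_mul, zero_mul]

lemma linearDM_isDifferenceMatrix [NeZero a] {α : ZMod a} (hα : 2 * α = -1)
    (h3 : IsUnit (3 : ZMod a)) : IsDifferenceMatrix (linearDM α) := by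
  have bij : ∀ c : ZMod a, IsUnit c → Function.Bijective fun i : ZMod a => c * i := fun c hc =>
    IsUnit.isUnit_iff_mulLeft_bijective.1 hc
  have uα : IsUnit α := IsUnit.of_mul_eq_one (-2) (by linear_combination -hα)
  have uα1 : IsUnit (α - 1) := by
    refine isUnit_of_mul_isUnit_left (y := -2) ?_
    convert h3 using 1
    linear_combination -hα
  have u1 : IsUnit (-1 : ZMod a) := isUnit_one.neg
  refine ⟨fun i => by simp [linearDM], fun j hj => ?_, fun j j' hj => ?_⟩
  · fin_cases j
    · simp at hj
    · simp [linearDM]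
    · simpa [linearDM] using bij α uα
  · fin_cases j <;> fin_cases j'
    · simp at hj
    · simpa [linearDM] using bij _ u1
    · simpa [linearDM] using bij _ uα.neg
    · simp [linearDM]
    · simp at hj
    · convert bij _ uα1.neg using 2 with i
      simp [linearDM]; ring
    · simpa [linearDM] using bij α uα
    · convert bij _ uα1 using 2 with i
      simp [linearDM]; ring
    · simp at hj

/-- Two of the linear forms determine the point because their determinant is a unit; for the last
two classes this is `α - 1`, where `-2 (α - 1) = 3`. -/
lemma eq_of_rowVal_eq [NeZero a] {α : ZMod a} (hα : 2 * α = -1) (h3 : IsUnit (3 : ZMod a))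
    {u u' : Fin 4} (hu : u ≠ u') {b b' : ZMod a × ZMod a} (h : rowVal α u b = rowVal α u b')
    (h' : rowVal α u' b = rowVal α u' b') : b = b' := by
  wlog hlt : u < u' generalizing u u'
  · exact this hu.symm h' h (lt_of_le_of_ne (not_lt.1 hlt) hu.symm)
  obtain ⟨v, q⟩ := b
  obtain ⟨v', q'⟩ := b'
  have main : v = v' → (v, q) = (v', q') := by
    rintro rfl
    fin_cases u' <;> simp_all [rowVal]
  fin_cases u <;> fin_cases u' <;> simp [rowVal] at hlt h h'
  · exact main h
  · exact main h
  · exact main h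
  · subst h; simpa using h'
  · subst h
    exact main (by linear_combination (-2) * h' + (v - v') * hα)
  · refine main (h3.mul_left_cancel ?_)
    linear_combination 2 * h - 2 * h' + (v - v') * hα

/-! ### Girth of the Tanner graph -/

lemma tannerGraph_adj_inl_inr {R C : Type*} [Fintype R] [Fintype C] {H : Matrix R C (ZMod 2)}
    {r : R} {c : C} : (tannerGraph H).Adj (Sum.inl r) (Sum.inr c) ↔ H r c = 1 := by
  simp [tannerGraph]

lemma tannerGraph_not_adj_inl {R C : Type*} [Fintype R] [Fintype C] {H : Matrix R C (ZMod 2)}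
    {r r' : R} : ¬ (tannerGraph H).Adj (Sum.inl r) (Sum.inl r') := by
  simp [tannerGraph]

lemma tannerGraph_not_adj_inr {R C : Type*} [Fintype R] [Fintype C] {H : Matrix R C (ZMod 2)}
    {c c' : C} : ¬ (tannerGraph H).Adj (Sum.inr c) (Sum.inr c') := by
  simp [tannerGraph]

/-- The Tanner graph has girth at least six when no two rows share two columns. -/
theorem six_le_egirth_tannerGraph {R C : Type*} [Fintype R] [Fintype C] {H : Matrix R C (ZMod 2)}
    (hH : ∀ r r' c c', r ≠ r' → H r c = 1 → H r c' = 1 → H r' c = 1 → H r' c' = 1 → c = c') :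
    6 ≤ (tannerGraph H).egirth := by
  rw [SimpleGraph.le_egirth]
  intro x w hw
  have h3 := hw.three_le_length
  have hev : Even w.length := by
    let col : (tannerGraph H).Coloring Bool := SimpleGraph.Coloring.mk Sum.isLeft (by
      rintro (r | c) (r' | c') h
      · exact absurd h tannerGraph_not_adj_inl
      · simp
      · simp
      · exact absurd h tannerGraph_not_adj_inr)
    exact (col.even_length_iff_congr w).2 Iff.rfl
  have h4 : w.length ≠ 4 := by
    intro h4
    have hnd := hw.support_nodup
    match w, h4 with
    | .cons (v := y) h1 (.cons (v := z) h2 (.cons (v := t) h3 (.cons h4 .nil))), _ =>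
      simp at hnd
      have hyt : y ≠ t := hnd.1.2.1
      have hzx : z ≠ x := hnd.2.1.2
      match x, y, z, t with
      | .inl r, .inr c, .inl r', .inr c' =>
        rw [tannerGraph_adj_inl_inr] at h1 h3
        rw [SimpleGraph.adj_comm, tannerGraph_adj_inl_inr] at h2 h4
        exact hyt (congrArg _ (hH r r' c c' (by simpa using hzx.symm) h1 h4 h2 h3))
      | .inr c, .inl r, .inr c', .inl r' =>
        rw [tannerGraph_adj_inl_inr] at h2 h4
        rw [SimpleGraph.adj_comm, tannerGraph_adj_inl_inr] at h1 h3
        exact hzx (congrArg _ (hH r r' c' c (by simpa using hyt) h2 h1 h3 h4))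
      | .inl _, .inl _, _, _ => exact tannerGraph_not_adj_inl h1
      | .inr _, .inr _, _, _ => exact tannerGraph_not_adj_inr h1
      | _, .inl _, .inl _, _ => exact tannerGraph_not_adj_inl h2
      | _, .inr _, .inr _, _ => exact tannerGraph_not_adj_inr h2
      | _, _, .inl _, .inl _ => exact tannerGraph_not_adj_inl h3
      | _, _, .inr _, .inr _ => exact tannerGraph_not_adj_inr h3
  obtain ⟨k, hk⟩ := hev
  have : 6 ≤ w.length := by omega
  exact_mod_cast this

theorem six_le_egirth_linearDM [NeZero a] {α : ZMod a} (hα : 2 * α = -1)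
    (h3 : IsUnit (3 : ZMod a)) : 6 ≤ (tannerGraph (parityCheck (linearDM α))).egirth := by
  refine six_le_egirth_tannerGraph ?_
  rintro ⟨u, r⟩ ⟨u', r'⟩ c c' hne h1 h2 h3' h4
  simp only [parityCheck_linearDM_apply, ite_eq_left_iff, zero_ne_one, imp_false,
    not_not] at h1 h2 h3' h4
  have hu : u ≠ u' := by
    rintro rfl
    exact hne (by rw [← h1, ← h3'])
  exact eq_of_rowVal_eq hα h3 hu (h1.trans h2.symm) (h3'.trans h4.symm)

/-! ### Quasi-cyclic structure -/

theorem isQuasiCyclic_linearDM [NeZero a] {α : ZMod a} (hα : 2 * α = -1)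
    (h2 : IsUnit (2 : ZMod a)) : IsQuasiCyclicParityCheck (parityCheck (linearDM α)) 4 a a := by
  obtain ⟨i2, hi2⟩ := h2.exists_right_inv
  -- At the point `(t, t + j)` the four forms equal `κ t + β j`. Relabelling row `κ s` as `s` turns
  -- incidence into `κ (s - t) = β j`, a condition on `s - t` alone. The inverse of `1 + α` is `2`.
  let κ : Fin 4 → ZMod a := ![1, 1, 2, 1 + α]
  let κ' : Fin 4 → ZMod a := ![1, 1, i2, 2]
  let β : Fin 4 → ZMod a := ![0, 1, 1, 1]
  have hκ : ∀ u, κ u * κ' u = 1 := by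
    intro u
    fin_cases u
    · simp [κ, κ']
    · simp [κ, κ']
    · simpa [κ, κ'] using hi2
    · simp only [κ, κ']
      change (1 + α) * 2 = 1
      linear_combination hα
  let φ : Fin a ≃+* ZMod a := ZMod.finEquiv a
  refine ⟨⟨fun x => (x.1, φ.symm (κ' x.1 * x.2)), fun y => (y.1, κ y.1 * φ y.2), ?_, ?_⟩,
    ⟨fun x => (φ.symm (x.2 - x.1), φ.symm x.1), fun y => (φ y.2, φ y.2 + φ y.1), ?_, ?_⟩, ?_⟩
  · rintro ⟨u, r⟩
    simp [← mul_assoc, hκ]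
  · rintro ⟨u, s⟩
    change (u, φ.symm (κ' u * (κ u * φ s))) = (u, s)
    rw [← mul_assoc, mul_comm (κ' u), hκ, one_mul, φ.symm_apply_apply]
  · rintro ⟨v, q⟩
    simp
  · rintro ⟨j, t⟩
    simp
  · intro i j
    refine ⟨fun x => if κ i * φ x = β i * φ j then 1 else 0, ?_⟩
    ext s t
    simp only [Matrix.of_apply, Matrix.reindex_apply, Matrix.submatrix_apply, Equiv.coe_fn_symm_mk,
      parityCheck_linearDM_apply, Matrix.circulant_apply]
    have hsub : φ (s - t) = φ s - φ t := map_sub φ s t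
    have hval : rowVal α i (φ t, φ t + φ j) = κ i * φ t + β i * φ j := by
      fin_cases i <;> simp [rowVal, κ, β] <;> ring
    simp only [hval, hsub, mul_sub, sub_eq_iff_eq_add']
    exact if_congr eq_comm rfl rfl

/-! ### Relations among the rows and the rate -/

section Rank

variable {a : ℕ}

/-- Every `x` is twice `x / 2`, and doubling is zero in `ZMod 2`. -/
lemma zmod_two_hom_eq_zero {A : Type*} [CommRing A] (h2 : IsUnit (2 : A)) {d : A → ZMod 2}
    (hd : ∀ x y, d (x + y) = d x + d y) (x : A) : d x = 0 := by
  obtain ⟨i2, hi2⟩ := h2.exists_right_inv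
  have : x = i2 * x + i2 * x := by linear_combination -x * hi2
  rw [this, hd, CharTwo.add_self_eq_zero]

/-- Vanishing second differences make `g - g 0` additive, hence zero. -/
lemma const_of_second_difference {A : Type*} [CommRing A] (h2 : IsUnit (2 : A)) {g : A → ZMod 2}
    (hg : ∀ x h k, g (x + h + k) + g (x + h) + g (x + k) + g x = 0) (x : A) : g x = g 0 := by
  have h0 : (2 : ZMod 2) = 0 := rfl
  have := zmod_two_hom_eq_zero h2 (d := fun x => g x + g 0) (fun x y => by
    have := hg 0 x y
    simp only [zero_add] at this
    linear_combination this - (g x + g y + g 0) * h0) x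
  linear_combination this - g 0 * h0

/-- Each first difference of `g` has vanishing second differences, so it is constant; hence the
second differences of `g` vanish. -/
lemma const_of_third_difference {A : Type*} [CommRing A] (h2 : IsUnit (2 : A)) {g : A → ZMod 2}
    (hg : ∀ x h k l, g (x + h + k + l) + g (x + h + k) + g (x + h + l) + g (x + h) +
      (g (x + k + l) + g (x + k) + g (x + l) + g x) = 0) (x : A) : g x = g 0 := by
  have h0 : (2 : ZMod 2) = 0 := rfl
  refine const_of_second_difference h2 (fun x h k => ?_) x
  have hc := fun y => const_of_second_difference h2 (g := fun y => g (y + h) + g y) (fun y k l => by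
    have := hg y h k l
    rw [add_right_comm y h k, add_right_comm (y + k) h l, add_right_comm y h l] at this
    linear_combination this) y
  have e1 := hc (x + k)
  have e2 := hc x
  rw [add_right_comm x k h] at e1
  linear_combination e1 + e2 + (g (0 + h) + g 0) * h0

lemma const_of_sum_rowVal_eq_zero {α : ZMod a} (hα : 2 * α = -1) (h2 : IsUnit (2 : ZMod a))
    (h3 : IsUnit (3 : ZMod a)) {f : Fin 4 × ZMod a → ZMod 2}
    (hf : ∀ b, ∑ u, f (u, rowVal α u b) = 0) (u : Fin 4) (r : ZMod a) : f (u, r) = f (u, 0) := by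
  have h0 : (2 : ZMod 2) = 0 := rfl
  obtain ⟨i3, hi3⟩ := h3.exists_right_inv
  have E : ∀ v q w z, w = v + q → z = α * v + q →
      f (0, v) + f (1, q) + f (2, w) + f (3, z) = 0 := by
    rintro v q w z rfl rfl
    have := hf (v, q)
    rw [Fin.sum_univ_four] at this
    exact this
  have c3 : ∀ r, f (3, r) = f (3, 0) := by
    -- The shifts `(0, h)`, `(-2k, 0)` and `(-2l/3, 2l/3)` preserve `v`, `q` and `v + q`
    -- respectively and raise `α v + q` by `h`, `k`, `l`. Summing over the eight points they span
    -- cancels the other three classes.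
    refine const_of_third_difference h2 (g := fun r => f (3, r)) fun x h k l => ?_
    have e000 := E 0 x x x (by ring) (by ring)
    have e100 := E 0 (x + h) (x + h) (x + h) (by ring) (by ring)
    have e010 := E (-2 * k) x (x - 2 * k) (x + k) (by ring) (by linear_combination k * hα)
    have e110 := E (-2 * k) (x + h) (x + h - 2 * k) (x + h + k) (by ring)
      (by linear_combination k * hα)
    have e001 := E (-2 * i3 * l) (x + 2 * i3 * l) x (x + l) (by ring)
      (by linear_combination i3 * l * hα - l * hi3)
    have e101 := E (-2 * i3 * l) (x + h + 2 * i3 * l) (x + h) (x + h + l) (by ring)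
      (by linear_combination i3 * l * hα - l * hi3)
    have e011 := E (-2 * k - 2 * i3 * l) (x + 2 * i3 * l) (x - 2 * k) (x + k + l) (by ring)
      (by linear_combination (k + i3 * l) * hα - l * hi3)
    have e111 := E (-2 * k - 2 * i3 * l) (x + h + 2 * i3 * l) (x + h - 2 * k) (x + h + k + l)
      (by ring) (by linear_combination (k + i3 * l) * hα - l * hi3)
    linear_combination e000 + e100 + e010 + e110 + e001 + e101 + e011 + e111 -
      (f (0, 0) + f (0, -2 * k) + f (0, -2 * i3 * l) + f (0, -2 * k - 2 * i3 * l) +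
        f (1, x) + f (1, x + h) + f (1, x + 2 * i3 * l) + f (1, x + h + 2 * i3 * l) +
        f (2, x) + f (2, x + h) + f (2, x - 2 * k) + f (2, x + h - 2 * k)) * h0
  have E' : ∀ v q, f (0, v) + f (1, q) + f (2, v + q) + f (3, 0) = 0 := fun v q => by
    rw [← c3 (α * v + q)]
    exact E v q _ _ rfl rfl
  have c2 : ∀ r, f (2, r) = f (2, 0) := by
    intro r
    -- With the fourth class constant, `f (2, x + y)` is a function of `x` plus a function of `y`,
    -- hence additive up to a constant.
    have := zmod_two_hom_eq_zero h2 (d := fun r => f (2, r) + f (2, 0)) (fun x y => by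
      have e1 := E' x y
      have e2 := E' x 0
      have e3 := E' 0 y
      have e4 := E' 0 0
      simp only [add_zero, zero_add] at e2 e3 e4
      linear_combination e1 + e2 + e3 + e4 - (f (0, x) + f (0, 0) + f (1, y) + f (1, 0) +
        2 * f (3, 0) + f (2, x) + f (2, y) + f (2, 0)) * h0) r
    linear_combination this - f (2, 0) * h0
  have c0 : ∀ r, f (0, r) = f (0, 0) := fun r => by
    have e1 := E' r 0
    have e2 := E' 0 0
    rw [c2 (r + 0)] at e1
    rw [c2 (0 + 0)] at e2
    linear_combination e1 - e2
  have c1 : ∀ r, f (1, r) = f (1, 0) := fun r => by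
    have e1 := E' 0 r
    have e2 := E' 0 0
    rw [c2 (0 + r)] at e1
    rw [c2 (0 + 0)] at e2
    linear_combination e1 - e2
  fin_cases u
  · exact c0 r
  · exact c1 r
  · exact c2 r
  · exact c3 r

/-- The relations among the rows: constant on each block row, with the constants summing to
zero. -/
def rowRelations (a : ℕ) : (Fin 3 → ZMod 2) →ₗ[ZMod 2] (Fin 4 × ZMod a → ZMod 2) :=
  LinearMap.funLeft (ZMod 2) (ZMod 2) Prod.fst ∘ₗ
    Matrix.mulVecLin (!![1, 0, 0; 0, 1, 0; 0, 0, 1; 1, 1, 1] : Matrix (Fin 4) (Fin 3) (ZMod 2))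

lemma rowRelations_apply (a : ℕ) (z : Fin 3 → ZMod 2) (u : Fin 4) (r : ZMod a) :
    rowRelations a z (u, r) = ![z 0, z 1, z 2, z 0 + z 1 + z 2] u := by
  fin_cases u <;>
    simp [rowRelations, LinearMap.funLeft_apply, dotProduct, Fin.sum_univ_three]

lemma rowRelations_injective (a : ℕ) : Function.Injective (rowRelations a) := by
  intro z z' h
  ext i
  have h' := fun u => congrFun h (u, 0)
  simp only [rowRelations_apply] at h'
  fin_cases i
  · exact h' 0
  · exact h' 1
  · exact h' 2

lemma ker_transpose_eq_range [NeZero a] {α : ZMod a} (hα : 2 * α = -1) (h2 : IsUnit (2 : ZMod a))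
    (h3 : IsUnit (3 : ZMod a)) :
    LinearMap.ker (parityCheck (linearDM α)).transpose.mulVecLin =
      LinearMap.range (rowRelations a) := by
  have h0 : (2 : ZMod 2) = 0 := rfl
  have hmem : ∀ f, f ∈ LinearMap.ker (parityCheck (linearDM α)).transpose.mulVecLin ↔
      ∀ b, ∑ u, f (u, rowVal α u b) = 0 := by
    intro f
    simp only [LinearMap.mem_ker, Matrix.mulVecLin_apply, funext_iff, Matrix.mulVec, dotProduct,
      Pi.zero_apply, Matrix.transpose_apply, Fintype.sum_prod_type, parityCheck_linearDM_apply,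
      ite_mul, one_mul, zero_mul, Finset.sum_ite_eq, Finset.mem_univ, if_true]
  ext f
  rw [hmem, LinearMap.mem_range]
  constructor
  · intro hf
    have hc := const_of_sum_rowVal_eq_zero hα h2 h3 hf
    refine ⟨![f (0, 0), f (1, 0), f (2, 0)], ?_⟩
    ext ⟨u, r⟩
    rw [rowRelations_apply, hc u r]
    have hs := hf (0, 0)
    rw [Fin.sum_univ_four, hc 0, hc 1, hc 2, hc 3] at hs
    fin_cases u
    · rfl
    · rfl
    · rfl
    · simp
      linear_combination hs - f (3, 0) * h0
  · rintro ⟨z, rfl⟩ b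
    simp only [rowRelations_apply, Fin.sum_univ_four]
    simp
    linear_combination (z 0 + z 1 + z 2) * h0

theorem rate_linearDM [NeZero a] {α : ZMod a} (hα : 2 * α = -1) (h2 : IsUnit (2 : ZMod a))
    (h3 : IsUnit (3 : ZMod a)) :
    rate (parityCheck (linearDM α)) = 1 - (4 * (a : ℚ) - 3) / (a : ℚ) ^ 2 := by
  set H := parityCheck (linearDM α) with hH
  -- Rank-nullity for `H` and for its transpose, which have equal rank.
  have e1 := H.mulVecLin.finrank_range_add_finrank_ker
  have e2 := H.transpose.mulVecLin.finrank_range_add_finrank_ker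
  rw [ker_transpose_eq_range hα h2 h3, LinearMap.finrank_range_of_inj (rowRelations_injective a)]
    at e2
  change H.transpose.rank + _ = _ at e2
  change H.rank + Module.finrank (ZMod 2) (code H) = _ at e1
  rw [Matrix.rank_transpose] at e2
  simp only [Module.finrank_fintype_fun_eq_card, Fintype.card_prod, Fintype.card_fin,
    ZMod.card] at e1 e2
  have q1 : (H.rank : ℚ) + Module.finrank (ZMod 2) (code H) = a * a := by exact_mod_cast e1
  have q2 : (H.rank : ℚ) + 3 = 4 * a := by exact_mod_cast e2
  have ha : (a : ℚ) ≠ 0 := by exact_mod_cast NeZero.ne a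
  rw [rate, Fintype.card_prod, ZMod.card]
  push_cast
  field_simp
  linear_combination q1 - q2

end Rank

/-! ### Minimum distance -/

section MinDist

variable {a : ℕ} [NeZero a]

/-- The explicit ten columns, as a list. -/
def tenList {R : Type*} [CommRing R] (α : R) : List (R × R) :=
  [(0, 2), (0, α + 1), (1, 2), (1, α), (2, 0), (2, 1), (-2, 1), (-2, α + 1), (-1, 0), (-1, α)]

lemma inv_eq_neg_two {α : ZMod a} (hα : 2 * α = -1) : α⁻¹ = -2 := by
  have hu : IsUnit α := IsUnit.of_mul_eq_one (-2) (by linear_combination -hα)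
  linear_combination (-2) * ZMod.mul_inv_of_unit α hu + α⁻¹ * hα

lemma tenColumns_eq {α : ZMod a} (hα : 2 * α = -1) : tenColumns α = (tenList α).toFinset := by
  have : (-2 : ZMod a) + 1 = -1 := by ring
  simp [tenColumns, tenList, inv_eq_neg_two hα, this]

lemma tenList_nodup {R : Type*} [CommRing R] [Nontrivial R] {α : R} (hα : 2 * α = -1)
    (h30 : IsUnit (30 : R)) : (tenList α).Nodup := by
  obtain ⟨i, hi⟩ := h30.exists_right_inv
  have h01 : (0 : R) ≠ 1 := zero_ne_one
  simp only [tenList, List.nodup_cons, List.mem_cons, List.not_mem_nil, or_false, Prod.mk.injEq,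
    not_or, not_and, List.nodup_nil, not_false_eq_true, and_true]
  refine ⟨⟨?_, ?_, ?_, ?_, ?_, ?_, ?_, ?_, ?_⟩, ⟨?_, ?_, ?_, ?_, ?_, ?_, ?_, ?_⟩,
    ⟨?_, ?_, ?_, ?_, ?_, ?_, ?_⟩, ⟨?_, ?_, ?_, ?_, ?_, ?_⟩, ⟨?_, ?_, ?_, ?_, ?_⟩,
    ⟨?_, ?_, ?_, ?_⟩, ⟨?_, ?_, ?_⟩, ⟨?_, ?_⟩, ?_⟩ <;>
    first
    | grind
    -- This handles `2 = -2`: then `4 = 0`, while `225 i ^ 2 * 4 = (30 i) ^ 2 = 1`.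
    | exact fun h => absurd
        (by linear_combination (-225 * i ^ 2) * h + (30 * i + 1) * hi : (0 : R) = 1) h01

lemma tenColumns_mem_code {α : ZMod a} [Nontrivial (ZMod a)] (hα : 2 * α = -1)
    (h30 : IsUnit (30 : ZMod a)) :
    (fun b => if b ∈ tenColumns α then (1 : ZMod 2) else 0) ∈ code (parityCheck (linearDM α)) := by
  have h0 : (2 : ZMod 2) = 0 := rfl
  rw [mem_code_linearDM_iff]
  intro u r
  have : ∀ b, (if rowVal α u b = r then (if b ∈ tenColumns α then (1 : ZMod 2) else 0) else 0) =
      if b ∈ tenColumns α then (if rowVal α u b = r then 1 else 0) else 0 := fun b => by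
    split_ifs <;> rfl
  rw [Finset.sum_congr rfl fun b _ => this b, Finset.sum_ite_mem, Finset.univ_inter,
    tenColumns_eq hα, List.sum_toFinset _ (tenList_nodup hα h30)]
  set I : ZMod a → ZMod 2 := fun x => if x = r then 1 else 0 with hI
  change ((tenList α).map (I ∘ rowVal α u)).sum = 0
  rw [← List.map_map]
  -- In each class the ten values form five pairs of formally equal entries, so the sum cancels in
  -- characteristic two for any `I`.
  have hval : (tenList α).map (rowVal α u) = ![[0, 0, 1, 1, 2, 2, -2, -2, -1, -1],
      [2, α + 1, 2, α, 0, 1, 1, α + 1, 0, α],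
      [2, α + 1, 3, α + 1, 2, 3, -1, α - 1, -1, α - 1],
      [2, α + 1, α + 2, -1, -1, 0, 2, α + 2, α + 1, 0]] u := by
    have e1 : (1 : ZMod a) + 2 = 3 := by norm_num
    have e2 : (2 : ZMod a) + 1 = 3 := by norm_num
    have e3 : (-2 : ZMod a) + 1 = -1 := by norm_num
    fin_cases u <;> simp [tenList, rowVal, e1, e2, e3]
    · exact ⟨by ring, by ring, by ring⟩
    · refine ⟨?_, ?_, ?_, ?_, ?_, ?_⟩ <;> first | linear_combination hα | linear_combination -hα
  rw [hval]
  clear_value I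
  fin_cases u
  · simp
    linear_combination (I 0 + I 1 + I 2 + I (-2) + I (-1)) * h0
  · simp
    linear_combination (I 0 + I 1 + I 2 + I α + I (α + 1)) * h0
  · simp
    linear_combination (I 2 + I 3 + I (-1) + I (α + 1) + I (α - 1)) * h0
  · simp
    linear_combination (I 2 + I 0 + I (-1) + I (α + 1) + I (α + 2)) * h0

lemma even_card_fiber {α : ZMod a} {x : ZMod a × ZMod a → ZMod 2}
    (hx : x ∈ code (parityCheck (linearDM α))) (u : Fin 4) (r : ZMod a) :
    Even ((Finset.univ.filter fun b => x b ≠ 0).filter fun b => rowVal α u b = r).card := by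
  have h := mem_code_linearDM_iff.1 hx u r
  refine ZMod.natCast_eq_zero_iff_even.1 (Eq.trans ?_ h)
  rw [Finset.filter_filter, Finset.card_filter]
  push_cast
  refine Finset.sum_congr rfl fun b _ => ?_
  have hb : x b = 0 ∨ x b = 1 := by
    generalize x b = y
    revert y
    decide
  rcases hb with hb | hb <;> simp [hb]

theorem ten_le_hammingNorm {α : ZMod a} (hα : 2 * α = -1) (h30 : IsUnit (30 : ZMod a))
    {x : ZMod a × ZMod a → ZMod 2} (hx : x ∈ code (parityCheck (linearDM α))) (hne : x ≠ 0) :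
    10 ≤ hammingNorm x := by
  have h2 : IsUnit (2 : ZMod a) := isUnit_of_mul_isUnit_left (y := 15) (by norm_num; exact h30)
  set S := Finset.univ.filter fun b => x b ≠ 0 with hS
  have hcard : hammingNorm x = S.card := rfl
  have hev := even_card_fiber hx
  -- The lines `v = r` partition the plane and each meets `S` evenly; this excludes nine points.
  have hSeven : Even S.card := by
    rw [Finset.card_eq_sum_card_fiberwise (f := rowVal α 0) (t := Finset.univ) (by simp)]
    exact Finset.even_sum _ fun r _ => hev 0 r
  have hSne : S.Nonempty := by
    obtain ⟨b, hb⟩ := Function.ne_iff.1 hne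
    exact ⟨b, by simpa [hS] using hb⟩
  have hpair : ∀ c, ∃ m : ZMod a × ZMod a → ZMod a × ZMod a, ∀ b ∈ S,
      m b ∈ S ∧ m b ≠ b ∧ m (m b) = b ∧ lineVal c (m b) = lineVal c b := by
    intro c
    have key : ∃ u : Fin 4, ∀ b b', rowVal α u b = rowVal α u b' → lineVal c b = lineVal c b' := by
      match c with
      | 0 => exact ⟨0, fun b b' h => by simpa [rowVal, lineVal, lineCoeff] using h⟩
      | 1 => exact ⟨1, fun b b' h => by simpa [rowVal, lineVal, lineCoeff] using h⟩
      | 2 => exact ⟨2, fun b b' h => by simpa [rowVal, lineVal, lineCoeff] using h⟩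
      -- Twice `α v + q` is `-v + 2 q`, the integral form used in the search; all indices from `3`
      -- on denote this class.
      | n + 3 =>
        refine ⟨3, fun b b' h => ?_⟩
        have h' : α * b.1 + b.2 = α * b'.1 + b'.2 := h
        simp only [lineVal, lineCoeff]
        push_cast
        linear_combination 2 * h' - (b.1 - b'.1) * hα
    obtain ⟨u, hu⟩ := key
    obtain ⟨m, hm⟩ := exists_pairing S (rowVal α u) (hev u)
    exact ⟨m, fun b hb => ⟨(hm b hb).1, (hm b hb).2.1, (hm b hb).2.2.1, hu _ _ (hm b hb).2.2.2⟩⟩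
  choose m hm using hpair
  have := eight_lt_card_of_isLineMatching h30 (m := m) (fun c b hb => hm c b hb) hSne
  obtain ⟨k, hk⟩ := hSeven
  omega

theorem hasMinDist_linearDM {α : ZMod a} [Nontrivial (ZMod a)] (hα : 2 * α = -1)
    (h30 : IsUnit (30 : ZMod a)) : HasMinDist (parityCheck (linearDM α)) 10 := by
  constructor
  · refine ⟨_, tenColumns_mem_code hα h30, 0, Submodule.zero_mem _, ?_, ?_⟩
    · intro h
      have := congrFun h (0, 2)
      simp [tenColumns] at this
    · rw [hammingDist_zero_right, hammingNorm]
      have : (Finset.univ.filter fun b => (if b ∈ tenColumns α then (1 : ZMod 2) else 0) ≠ 0) =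
          tenColumns α := by ext; simp
      rw [this, tenColumns_eq hα, List.toFinset_card_of_nodup (tenList_nodup hα h30)]
      rfl
  · rintro k ⟨x, hx, y, hy, hxy, rfl⟩
    rw [hammingDist_eq_hammingNorm]
    exact ten_le_hammingNorm hα h30 (add_mem (neg_mem hx) hy) fun h => hxy (neg_add_eq_zero.1 h)

end MinDist

end LDPC

/-! ### The main theorem -/

theorem mainTheorem2 (a : ℕ) [NeZero a] (ha : 3 ≤ a) (hodd : Odd a)
    (h3 : Nat.Coprime a 3) (h5 : Nat.Coprime a 5)
    (α : ZMod a) (hα : α = (((a - 1) / 2 : ℕ) : ZMod a))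
    (D : Matrix (ZMod a) (Fin 3) (ZMod a)) (hD : D = LDPC.linearDM α)
    (H : Matrix (Fin 4 × ZMod a) (ZMod a × ZMod a) (ZMod 2)) (hH : H = LDPC.parityCheck D) :
    (LDPC.IsDifferenceMatrix D ∧ LDPC.IsStandardForm D) ∧
    LDPC.IsRegularParityCheck H (a ^ 2) 4 a ∧
    LDPC.IsQuasiCyclicParityCheck H 4 a a ∧
    6 ≤ (LDPC.tannerGraph H).egirth ∧
    LDPC.rate H = 1 - (4 * (a : ℚ) - 3) / (a : ℚ) ^ 2 ∧
    LDPC.HasMinDist H 10 ∧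
    ((LDPC.tenColumns α).card = 10 ∧
      (fun b => if b ∈ LDPC.tenColumns α then (1 : ZMod 2) else 0) ∈ LDPC.code H) := by
  subst hH hD
  have : Fact (1 < a) := ⟨by omega⟩
  have hα2 : 2 * α = -1 := by
    obtain ⟨k, rfl⟩ := hodd
    have hk : (((2 * k + 1 : ℕ) : ZMod (2 * k + 1))) = 0 := ZMod.natCast_self _
    rw [hα, show (2 * k + 1 - 1) / 2 = k by omega]
    push_cast at hk
    linear_combination hk
  have u2 : IsUnit (2 : ZMod a) := by
    exact_mod_cast (ZMod.isUnit_iff_coprime 2 a).2 (Nat.coprime_two_left.2 hodd)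
  have u3 : IsUnit (3 : ZMod a) := by
    exact_mod_cast (ZMod.isUnit_iff_coprime 3 a).2 h3.symm
  have u5 : IsUnit (5 : ZMod a) := by
    exact_mod_cast (ZMod.isUnit_iff_coprime 5 a).2 h5.symm
  have u30 : IsUnit (30 : ZMod a) := by
    convert (u2.mul u3).mul u5 using 1
    norm_num
  refine ⟨⟨LDPC.linearDM_isDifferenceMatrix hα2 u3, fun i => rfl⟩,
    LDPC.isRegularParityCheck_linearDM α, LDPC.isQuasiCyclic_linearDM hα2 u2,
    LDPC.six_le_egirth_linearDM hα2 u3, LDPC.rate_linearDM hα2 u2 u3,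
    LDPC.hasMinDist_linearDM hα2 u30, ?_, LDPC.tenColumns_mem_code hα2 u30⟩
  rw [LDPC.tenColumns_eq hα2, List.toFinset_card_of_nodup (LDPC.tenList_nodup hα2 u30)]
  rfl
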